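/- Let $d \ge 2$ and $k \ge 1$ be integers, and let $T_d$ be the $d$-regular tree (the infinite tree in which every vertex has degree $d$). Fix a legal labelling $l$ of $T_d$: a map from the set of (undirected) edges of $T_d$ to a set of $d$ labels that restricts, for every vertex $x$, to a bijection from the set of edges at $x$ onto the set of labels. For a vertex $x$ let $B(x,n)$ be the set of vertices at distance at most $n$ from $x$ (or the subtree they span). Let $B_{d,k}$ be a fixed copy of the labelled ball of radius $k$ around a vertex of $T_d$, and for each vertex $x$ let $l_x^k : B(x,k) \to B_{d,k}$ be the unique isomorphism that sends $x$ to the centre and preserves the labels of the edges. For $g \in \mathrm{Aut}(T_d)$ and a vertex $x$ put $\sigma_k(g,x) := l_{gx}^k \circ g \circ (l_x^k)^{-1} \in \mathrm{Aut}(B_{d,k})$. For a subgroup $F \le \mathrm{Aut}(B_{d,k})$ the generalised universal group is $$U_k(F) := \{ g \in \mathrm{Aut}(T_d) : \sigma_k(g,x) \in F \text{ for every vertex } x \}.$$ For a subgroup $G \le \mathrm{Aut}(T_d)$ let $G^{+_k}$ be the subgroup generated by the pointwise stabilisers in $G$ of the sets $B(v,k) \cap B(w,k)$, where $\{v,w\}$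 runs over the edges of $T_d$. Give $\mathrm{Aut}(T_d)$ the permutation topology (a basis consists of the sets $\{g : g(x) = g_0(x) \text{ for all } x \in S\}$ with $g_0 \in \mathrm{Aut}(T_d)$ and $S$ a finite set of vertices) and its subgroups the subspace topology. Then, for every subgroup $F \le \mathrm{Aut}(B_{d,k})$, the group $U_k(F)^{+_k}$ has the closed range property: for every Hausdorff topological group $H$ and every continuous homomorphism $\varphi : U_k(F)^{+_k} \to H$, the image of $\varphi$ is closed in $H$. -/

import Mathlib

universe u w

/-- A topological group `G` has the closed range property if every continuous homomorphism from
`G` to an arbitrary (Hausdorff) topological group `H` has closed range. -/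
def HasClosedRangeProperty (G : Type u) [Group G] [TopologicalSpace G] : Prop :=
  ∀ (H : Type w) [Group H] [TopologicalSpace H] [IsTopologicalGroup H] [T2Space H]
    (φ : G →* H), Continuous φ → IsClosed (Set.range φ)

namespace TreeAut

/-! ### The permutation topology on the automorphism group of a graph -/

section Topology

variable {V : Type u} {T : SimpleGraph V}

/-- The set of all automorphisms that agree with `g₀` on `S`. -/
def basicNhd (g₀ : T ≃g T) (S : Set V) : Set (T ≃g T) :=
  {g | ∀ x ∈ S, g x = g₀ x}

/-- The permutation topology on `Aut(T)`: it is generated by the sets of all automorphisms that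
agree with a given one on a given finite set of vertices. -/
instance permutationTopology : TopologicalSpace (T ≃g T) :=
  TopologicalSpace.generateFrom
    {U | ∃ (g₀ : T ≃g T) (S : Set V), S.Finite ∧ U = basicNhd g₀ S}

theorem isOpen_basicNhd (g₀ : T ≃g T) {S : Set V} (hS : S.Finite) :
    IsOpen (basicNhd g₀ S) :=
  TopologicalSpace.isOpen_generateFrom_of_mem ⟨g₀, S, hS, rfl⟩

theorem isTopologicalBasis_basicNhd :
    TopologicalSpace.IsTopologicalBasis
      {U : Set (T ≃g T) | ∃ (g₀ : T ≃g T) (S : Set V), S.Finite ∧ U = basicNhd g₀ S} where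
  exists_subset_inter := by
    rintro _ ⟨g₁, S₁, h₁, rfl⟩ _ ⟨g₂, S₂, h₂, rfl⟩ g ⟨hg₁, hg₂⟩
    refine ⟨basicNhd g (S₁ ∪ S₂), ⟨g, _, h₁.union h₂, rfl⟩, fun _ _ => rfl, fun f hf => ⟨?_, ?_⟩⟩
    · intro x hx
      rw [hf x (Or.inl hx), hg₁ x hx]
    · intro x hx
      rw [hf x (Or.inr hx), hg₂ x hx]
  sUnion_eq := by
    refine Set.eq_univ_of_forall fun g => ?_
    exact ⟨basicNhd g ∅, ⟨g, ∅, Set.finite_empty, rfl⟩, fun _ _ => rfl⟩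
  eq_generateFrom := rfl

instance isTopologicalGroup_aut : IsTopologicalGroup (T ≃g T) where
  continuous_mul := by
    rw [isTopologicalBasis_basicNhd.continuous_iff]
    rintro _ ⟨g₀, S, hS, rfl⟩
    rw [isOpen_iff_forall_mem_open]
    rintro ⟨a, b⟩ hab
    refine ⟨basicNhd a (b '' S) ×ˢ basicNhd b S, ?_,
      (isOpen_basicNhd a (hS.image b)).prod (isOpen_basicNhd b hS), fun _ _ => rfl, fun _ _ => rfl⟩
    rintro ⟨a', b'⟩ ⟨ha, hb⟩ x hx
    have h1 : b' x = b x := hb x hx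
    have h2 : a' (b x) = a (b x) := ha _ ⟨x, hx, rfl⟩
    have h3 : a (b x) = g₀ x := hab x hx
    change a' (b' x) = g₀ x
    rw [h1, h2, h3]
  continuous_inv := by
    rw [isTopologicalBasis_basicNhd.continuous_iff]
    rintro _ ⟨g₀, S, hS, rfl⟩
    rw [isOpen_iff_forall_mem_open]
    intro a ha
    refine ⟨basicNhd a (a.symm '' S), ?_, isOpen_basicNhd a (hS.image _), fun _ _ => rfl⟩
    intro b hb x hx
    have h1 : b (a.symm x) = a (a.symm x) := hb _ ⟨x, hx, rfl⟩
    have h2 : a.symm x = g₀ x := ha x hx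
    change b.symm x = g₀ x
    rw [← h2, RelIso.symm_apply_eq, h1, RelIso.apply_symm_apply]

end Topology

/-! ### Balls and the subgroup generated by fixators of edge neighbourhoods -/

section Plus

variable {V : Type u} (T : SimpleGraph V)

/-- The ball `B(v, n)`: the set of vertices at distance at most `n` from `v`. -/
def closedBall (v : V) (n : ℕ) : Set V := {x | T.dist v x ≤ n}

variable {T}

/-- The pointwise stabiliser in `G` of a set `S` of vertices. -/
def fixator (G : Subgroup (T ≃g T)) (S : Set V) : Subgroup (T ≃g T) where
  carrier := {g | g ∈ G ∧ ∀ x ∈ S, g x = x}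
  one_mem' := ⟨G.one_mem, fun _ _ => rfl⟩
  mul_mem' := by
    rintro a b ⟨ha, ha'⟩ ⟨hb, hb'⟩
    refine ⟨G.mul_mem ha hb, fun x hx => ?_⟩
    rw [RelIso.mul_apply, hb' x hx, ha' x hx]
  inv_mem' := by
    rintro a ⟨ha, ha'⟩
    refine ⟨G.inv_mem ha, fun x hx => ?_⟩
    conv_lhs => rw [← ha' x hx]
    exact RelIso.inv_apply_self a x

/-- The group `G^{+_k}` generated by the fixators in `G` of `B(v, k) ∩ B(w, k)`, where `{v, w}`
runs over the edges of `T`. -/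
def plusSubgroup (G : Subgroup (T ≃g T)) (k : ℕ) : Subgroup (T ≃g T) :=
  Subgroup.closure
    (⋃ (v : V) (w : V) (_ : T.Adj v w),
      (fixator G (closedBall T v k ∩ closedBall T w k) : Set (T ≃g T)))

end Plus

/-! ### Legal labellings and the labelled ball `B_{d,k}` -/

/-- A legal labelling of a graph by `d` labels: the (undirected) edges are labelled in such a way
that at every vertex each label occurs on exactly one of the edges at that vertex. -/
structure LegalLabelling {V : Type u} (T : SimpleGraph V) (d : ℕ) where
  /-- the label of each edge -/
  label : T.EdgeLabeling (Fin d)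
  bijective_label :
    ∀ v : V, Function.Bijective (fun x : T.neighborSet v => label.get v x.1 x.2)

/-- The vertices of `B_{d,k}`: words of length at most `k` in `d` letters without two equal
consecutive letters. The empty word is the centre of the ball. -/
def BallVertex (d k : ℕ) : Type :=
  {s : List (Fin d) // s.IsChain (· ≠ ·) ∧ s.length ≤ k}

/-- The tree `B_{d,k}`, a ball of radius `k` in the `d`-regular tree: a word `s` is joined to the
words `i :: s`, by an edge that carries the label `i`. -/
def ballGraph (d k : ℕ) : SimpleGraph (BallVertex d k) where
  Adj s t := (∃ i, t.1 = i :: s.1) ∨ (∃ i, s.1 = i :: t.1)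
  symm := ⟨fun _ _ h => h.symm⟩
  loopless := ⟨by
    rintro s (⟨i, h⟩ | ⟨i, h⟩) <;> simpa using congrArg List.length h⟩

namespace LegalLabelling

variable {V : Type u} {T : SimpleGraph V} {d : ℕ} (l : LegalLabelling T d)

/-- The neighbour of `v` across the edge at `v` with label `i`. -/
noncomputable def nbr (v : V) (i : Fin d) : V :=
  ((l.bijective_label v).2 i).choose.1

theorem adj_nbr (v : V) (i : Fin d) : T.Adj v (l.nbr v i) :=
  ((l.bijective_label v).2 i).choose.2

theorem label_nbr (v : V) (i : Fin d) : l.label.get v (l.nbr v i) (l.adj_nbr v i) = i :=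
  ((l.bijective_label v).2 i).choose_spec

theorem nbr_label {v x : V} (h : T.Adj v x) : l.nbr v (l.label.get v x h) = x := by
  have := (l.bijective_label v).1
    (a₁ := ⟨l.nbr v (l.label.get v x h), l.adj_nbr _ _⟩) (a₂ := ⟨x, h⟩) (l.label_nbr _ _)
  exact congrArg Subtype.val this

theorem nbr_injective (v : V) {i j : Fin d} (h : l.nbr v i = l.nbr v j) : i = j := by
  rw [← l.label_nbr v i, ← l.label_nbr v j]
  congr 1

theorem nbr_nbr (v : V) (i : Fin d) : l.nbr (l.nbr v i) i = v := by
  have h : l.label.get (l.nbr v i) v (l.adj_nbr v i).symm = i := by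
    rw [SimpleGraph.EdgeLabeling.get_comm, l.label_nbr]
  conv_lhs => rw [← h]
  rw [h]
  have := l.nbr_label (l.adj_nbr v i).symm
  rwa [h] at this

/-- The end of the walk that starts at `x` and follows the labels of a word `s`, where the first
step is the last letter of `s`. -/
noncomputable def follow (x : V) : List (Fin d) → V
  | [] => x
  | i :: s => l.nbr (follow x s) i

theorem parent_unique (hT : T.IsTree) {x v a b : V} (ha : T.Adj a v) (hb : T.Adj b v)
    (hda : T.dist x v = T.dist x a + 1) (hdb : T.dist x v = T.dist x b + 1) : a = b := by
  obtain ⟨p, hp⟩ := hT.connected.exists_walk_length_eq_dist x a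
  obtain ⟨q, hq⟩ := hT.connected.exists_walk_length_eq_dist x b
  have h1 : (p.concat ha).IsPath :=
    SimpleGraph.Walk.isPath_of_length_eq_dist _ (by rw [SimpleGraph.Walk.length_concat]; omega)
  have h2 : (q.concat hb).IsPath :=
    SimpleGraph.Walk.isPath_of_length_eq_dist _ (by rw [SimpleGraph.Walk.length_concat]; omega)
  have h := (hT.isAcyclic.subsingleton_path x v).elim ⟨_, h1⟩ ⟨_, h2⟩
  have h' := congrArg (fun r : T.Path x v => r.1.penultimate) h
  simpa using h'

theorem dist_follow (hT : T.IsTree) (x : V) :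
    ∀ s : List (Fin d), s.IsChain (· ≠ ·) → T.dist x (l.follow x s) = s.length
  | [], _ => by simp [follow]
  | [i], _ => by
    simpa [follow] using SimpleGraph.dist_eq_one_iff_adj.2 (l.adj_nbr x i)
  | i :: j :: s, h => by
    rw [List.isChain_cons_cons] at h
    have h1 := dist_follow hT x (j :: s) h.2
    have h0 := dist_follow hT x s h.2.tail
    have hadj := l.adj_nbr (l.follow x (j :: s)) i
    rcases hT.dist_eq_dist_add_one_of_adj x hadj with h2 | h2
    · exfalso
      have hs : l.nbr (l.follow x (j :: s)) i = l.follow x s :=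
        parent_unique hT hadj.symm (l.adj_nbr (l.follow x s) j) h2
          (by rw [h1, h0]; rfl)
      have hs' : l.nbr (l.follow x (j :: s)) j = l.follow x s := l.nbr_nbr _ _
      exact h.1 (l.nbr_injective _ (hs.trans hs'.symm))
    · change T.dist x (l.nbr (l.follow x (j :: s)) i) = _
      rw [h2, h1]
      rfl

theorem isChain_cons_of_dist (hT : T.IsTree) (x : V) {s : List (Fin d)}
    (hs : s.IsChain (· ≠ ·)) {i : Fin d}
    (h : T.dist x (l.nbr (l.follow x s) i) = s.length + 1) : (i :: s).IsChain (· ≠ ·) := by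
  cases s with
  | nil => simp
  | cons j s =>
    rw [List.isChain_cons_cons]
    refine ⟨?_, hs⟩
    rintro rfl
    have h1 : l.nbr (l.follow x (i :: s)) i = l.follow x s := l.nbr_nbr _ _
    rw [h1, l.dist_follow hT x s hs.tail] at h
    simp only [List.length_cons] at h
    omega

theorem follow_injective (hT : T.IsTree) (x : V) :
    ∀ s t : List (Fin d), s.IsChain (· ≠ ·) → t.IsChain (· ≠ ·) →
      l.follow x s = l.follow x t → s = t
  | [], t, hs, ht, h => by
    have h1 := l.dist_follow hT x t ht
    rw [← h, l.dist_follow hT x [] hs] at h1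
    exact (List.eq_nil_of_length_eq_zero h1.symm).symm
  | i :: s, [], hs, ht, h => by
    have h1 := l.dist_follow hT x _ hs
    rw [h, l.dist_follow hT x [] ht] at h1
    simp at h1
  | i :: s, j :: t, hs, ht, h => by
    have hp : l.follow x s = l.follow x t := by
      refine parent_unique hT (v := l.follow x (i :: s)) (x := x) (l.adj_nbr _ i) ?_ ?_ ?_
      · rw [h]
        exact l.adj_nbr _ j
      · rw [l.dist_follow hT x _ hs, l.dist_follow hT x s hs.tail]
        rfl
      · rw [h, l.dist_follow hT x _ ht, l.dist_follow hT x t ht.tail]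
        rfl
    have hst := follow_injective hT x s t hs.tail ht.tail hp
    subst hst
    rw [l.nbr_injective _ h]

theorem exists_follow_eq (hT : T.IsTree) (x : V) (n : ℕ) :
    ∀ v : V, T.dist x v = n →
      ∃ s : List (Fin d), s.IsChain (· ≠ ·) ∧ s.length = n ∧ l.follow x s = v := by
  induction n with
  | zero =>
    intro v hv
    exact ⟨[], by simp, rfl, (hT.connected.dist_eq_zero_iff.1 hv)⟩
  | succ n ih =>
    intro v hv
    obtain ⟨p, hp⟩ := hT.connected.exists_walk_length_eq_dist x v
    have hn : ¬ p.Nil := by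
      intro h
      rw [← SimpleGraph.Walk.length_eq_zero_iff] at h
      omega
    have hadj : T.Adj p.penultimate v := p.adj_penultimate hn
    have hd : T.dist x p.penultimate = n := by
      have h1 := SimpleGraph.dist_le p.dropLast
      have h2 : p.dropLast.length = n := by
        simp [SimpleGraph.Walk.dropLast, hp, hv]
      rcases hT.dist_eq_dist_add_one_of_adj x hadj with h3 | h3 <;> omega
    obtain ⟨s, hs, hlen, hf⟩ := ih _ hd
    have hv' : l.nbr (l.follow x s) (l.label.get p.penultimate v hadj) = v := by
      rw [hf, l.nbr_label]
    refine ⟨l.label.get _ v hadj :: s, ?_, by simp [hlen], hv'⟩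
    exact l.isChain_cons_of_dist hT x hs (by rw [hv', hv, hlen])

theorem adj_follow_iff (hT : T.IsTree) (x : V) {s t : List (Fin d)}
    (hs : s.IsChain (· ≠ ·)) (ht : t.IsChain (· ≠ ·)) :
    T.Adj (l.follow x s) (l.follow x t) ↔ (∃ i, t = i :: s) ∨ (∃ i, s = i :: t) := by
  have key : ∀ s t : List (Fin d), s.IsChain (· ≠ ·) → t.IsChain (· ≠ ·) →
      T.Adj (l.follow x s) (l.follow x t) →
      T.dist x (l.follow x t) = T.dist x (l.follow x s) + 1 → ∃ i, t = i :: s := by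
    intro s t hs ht hadj hd
    have h1 := l.nbr_label hadj
    refine ⟨_, l.follow_injective hT x _ _ ht
      (l.isChain_cons_of_dist hT x hs (i := l.label.get _ _ hadj) ?_) h1.symm⟩
    rw [h1, hd, l.dist_follow hT x s hs]
  constructor
  · intro hadj
    rcases hT.dist_eq_dist_add_one_of_adj x hadj with h | h
    · exact Or.inr (key t s ht hs hadj.symm h)
    · exact Or.inl (key s t hs ht hadj h)
  · rintro (⟨i, rfl⟩ | ⟨i, rfl⟩)
    · exact l.adj_nbr _ i
    · exact (l.adj_nbr _ i).symm

/-- The isomorphism from `B_{d,k}` to the ball `B(x, k)` of the tree `T` that maps the centre to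
`x` and preserves the labels of edges. It is the inverse of the map `l_x^k : B(x, k) → B_{d,k}`. -/
noncomputable def ballIso (hT : T.IsTree) (k : ℕ) (x : V) :
    ballGraph d k ≃g T.induce (closedBall T x k) where
  toEquiv := Equiv.ofBijective
    (fun s => ⟨l.follow x s.1, (l.dist_follow hT x s.1 s.2.1).trans_le s.2.2⟩) (by
      constructor
      · intro s t h
        exact Subtype.ext (l.follow_injective hT x _ _ s.2.1 t.2.1 (congrArg Subtype.val h))
      · rintro ⟨v, hv⟩
        obtain ⟨s, hs, hlen, hf⟩ := l.exists_follow_eq hT x _ v rfl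
        exact ⟨⟨s, hs, hlen.trans_le hv⟩, Subtype.ext hf⟩)
  map_rel_iff' {s t} := l.adj_follow_iff hT x s.2.1 t.2.1

@[simp]
theorem coe_ballIso (hT : T.IsTree) (k : ℕ) (x : V) (s : BallVertex d k) :
    (l.ballIso hT k x s : V) = l.follow x s.1 := rfl

/-- The isomorphism `l_x^k` respects labels: the edge of `B_{d,k}` joining `s` to `i :: s`, which
has the label `i`, corresponds to an edge of `T` with the label `i`. -/
theorem label_ballIso (hT : T.IsTree) (k : ℕ) (x : V) {s t : BallVertex d k} {i : Fin d}
    (h : t.1 = i :: s.1)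
    (hadj : T.Adj (l.ballIso hT k x s : V) (l.ballIso hT k x t : V)) :
    l.label.get (l.ballIso hT k x s : V) (l.ballIso hT k x t : V) hadj = i := by
  obtain ⟨t, ht⟩ := t
  subst h
  exact l.label_nbr (l.follow x s.1) i

end LegalLabelling

section Universal

variable {V : Type u} {T : SimpleGraph V} {d : ℕ}

theorem dist_apply (g : T ≃g T) (x y : V) : T.dist (g x) (g y) = T.dist x y := by
  have key : ∀ (f : T ≃g T) (a b : V), T.dist (f a) (f b) ≤ T.dist a b := by
    intro f a b
    by_cases h : T.Reachable a b
    · obtain ⟨p, hp⟩ := h.exists_walk_length_eq_dist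
      rw [← hp, ← SimpleGraph.Walk.length_map f.toHom p]
      exact SimpleGraph.dist_le _
    · have h' : ¬ T.Reachable (f a) (f b) := fun hr => h (by
        have := hr.map f.symm.toHom
        simpa using this)
      rw [SimpleGraph.dist_eq_zero_of_not_reachable h']
      exact Nat.zero_le _
  refine le_antisymm (key g x y) ?_
  simpa using key g.symm (g x) (g y)

/-- The restriction of an automorphism `g` to an isomorphism from `B(x, k)` to `B(g x, k)`. -/
def restrictBall (g : T ≃g T) (k : ℕ) (x : V) :
    T.induce (closedBall T x k) ≃g T.induce (closedBall T (g x) k) where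
  toEquiv := g.toEquiv.subtypeEquiv (fun v => by
    change T.dist x v ≤ k ↔ T.dist (g x) (g v) ≤ k
    rw [dist_apply])
  map_rel_iff' := g.map_rel_iff

/-- The `k`-local action `σ_k(g, x) = l_{g x}^k ∘ g ∘ (l_x^k)⁻¹` of `g` at the vertex `x`, an
automorphism of `B_{d,k}`. -/
noncomputable def localAction (hT : T.IsTree) (l : LegalLabelling T d) (k : ℕ) (g : T ≃g T)
    (x : V) : ballGraph d k ≃g ballGraph d k :=
  ((l.ballIso hT k x).trans (restrictBall g k x)).trans (l.ballIso hT k (g x)).symm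

theorem follow_localAction (hT : T.IsTree) (l : LegalLabelling T d) (k : ℕ) (g : T ≃g T) (x : V)
    (s : BallVertex d k) :
    l.follow (g x) (localAction hT l k g x s).1 = g (l.follow x s.1) := by
  rw [← l.coe_ballIso hT k]
  change ((l.ballIso hT k (g x)) ((l.ballIso hT k (g x)).symm _) : V) = _
  rw [RelIso.apply_symm_apply]
  rfl

theorem localAction_unique (hT : T.IsTree) (l : LegalLabelling T d) (k : ℕ) (g : T ≃g T) (x : V)
    (α : ballGraph d k ≃g ballGraph d k)
    (h : ∀ s, l.follow (g x) (α s).1 = g (l.follow x s.1)) : localAction hT l k g x = α := by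
  refine RelIso.ext fun s => Subtype.ext ?_
  exact l.follow_injective hT (g x) _ _ (localAction hT l k g x s).2.1 (α s).2.1
    ((follow_localAction hT l k g x s).trans (h s).symm)

theorem localAction_one (hT : T.IsTree) (l : LegalLabelling T d) (k : ℕ) (x : V) :
    localAction hT l k 1 x = 1 :=
  localAction_unique hT l k 1 x 1 fun _ => rfl

theorem localAction_mul (hT : T.IsTree) (l : LegalLabelling T d) (k : ℕ) (g h : T ≃g T) (x : V) :
    localAction hT l k (g * h) x = localAction hT l k g (h x) * localAction hT l k h x := by
  refine localAction_unique hT l k _ x _ fun s => ?_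
  rw [RelIso.mul_apply, RelIso.mul_apply, RelIso.mul_apply, follow_localAction,
    follow_localAction]

/-- The generalised universal group `U_k(F)`, for a subgroup `F` of `Aut(B_{d,k})`: the group of
all automorphisms of `T` all of whose `k`-local actions belong to `F`. -/
def universalGroup (hT : T.IsTree) (l : LegalLabelling T d) (k : ℕ)
    (F : Subgroup (ballGraph d k ≃g ballGraph d k)) : Subgroup (T ≃g T) where
  carrier := {g | ∀ x, localAction hT l k g x ∈ F}
  one_mem' x := by
    rw [localAction_one]
    exact F.one_mem
  mul_mem' {a b} ha hb x := by
    rw [localAction_mul]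
    exact F.mul_mem (ha (b x)) (hb x)
  inv_mem' {a} ha x := by
    have h := localAction_mul hT l k a a⁻¹ x
    rw [mul_inv_cancel, localAction_one] at h
    rw [← inv_eq_of_mul_eq_one_right h.symm]
    exact F.inv_mem (ha _)

end Universal

end TreeAut

/-!
# Closed range of the groups `U_k(F)^{+_k}`

Write `N` for `U_k(F)^{+_k}`, let `φ : N → H` be a continuous homomorphism and `y` a point of the
closure of its image. There is an ultrafilter `L` on `N` along which `φ` tends to `y`.

If `L` does not move a base vertex `x₀` arbitrarily far away, then by local finiteness `L` converges
pointwise to an automorphism (`exists_eventually_apply_eq`). It belongs to `N`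
(`mem_plusSubgroup_of_eventually`), and `φ` maps it to `y`.

Otherwise `g⁻¹ x₀` tends along `L` to an end `ξ` and `g x₀` to an end `η`. Ends are not formalised:
that `ξ` lies in a half-tree `A` is expressed by `g⁻¹ x ∈ A` for `L`-almost all `g`, for every
vertex `x`. If `n ∈ N` fixes pointwise a half-tree that contains `ξ`, then `g n g⁻¹` tends to `1`,
while its image tends to `y φ(n) y⁻¹`; so `φ(n) = 1` (`map_eq_one_of_eventuallyInto`).
The same follows for every `n ∈ N` that fixes some half-tree `A`, if `d ≥ 3`
(`map_eq_one_of_fixes_halfTree`). It is enough to find `m ∈ N` with `ξ ∈ m A`, as `m n m⁻¹` fixes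
`m A`. If `ξ` is not in `A`, there is room for an inversion `t` of an edge that preserves the labels
and moves both `ξ` and `η` into `A`. It belongs to `U_k(F)`, which normalises `N`, so
`m = t g t⁻¹` belongs to `N` for `g` in `N`; and by north-south dynamics `m⁻¹` maps the complement
of `A` into `A` for `L`-almost all `g` (`eventually_inv_maps_halfTree`).

By the independence property `P_k` (`exists_mul_eq_of_mem_fixator`) the group `N` is generated by
elements that fix a half-tree, so `φ` is trivial and `y = 1`. If `d = 2`, the tree is a line and `N`
is trivial (`eq_one_of_fixed_of_adj`).
-/

namespace TreeAut

/-! ### Half-trees -/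

section HalfTree

variable {V : Type u} {T : SimpleGraph V}

/-- The half-tree cut off by the edge from `v` to `w` that contains `w`: the vertices that are
closer to `w` than to `v`. -/
def halfTree (T : SimpleGraph V) (v w : V) : Set V := {x | T.dist x w < T.dist x v}

theorem apply_mem_halfTree_iff (g : T ≃g T) {v w x : V} :
    g x ∈ halfTree T (g v) (g w) ↔ x ∈ halfTree T v w := by
  simp only [halfTree, Set.mem_ofPred_eq, dist_apply]

theorem dist_inv_apply (g : T ≃g T) (x y : V) : T.dist (g⁻¹ x) y = T.dist x (g y) := by
  rw [← dist_apply g, RelIso.apply_inv_self]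

theorem inv_apply_mem_halfTree_iff (g : T ≃g T) {v w x : V} :
    g⁻¹ x ∈ halfTree T v w ↔ x ∈ halfTree T (g v) (g w) := by
  rw [← apply_mem_halfTree_iff g, RelIso.apply_inv_self]

theorem mem_halfTree_swap (hT : T.IsTree) {v w x : V} (h : T.Adj v w) :
    x ∈ halfTree T w v ↔ x ∉ halfTree T v w := by
  have := hT.dist_eq_dist_add_one_of_adj x h
  simp only [halfTree, Set.mem_ofPred_eq]
  omega

/-- The only edge that leaves a half-tree is the one that cuts it off. -/
theorem eq_of_adj_of_mem_halfTree (hT : T.IsTree) {v w x y : V} (h : T.Adj v w)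
    (hxy : T.Adj x y) (hx : x ∈ halfTree T v w) (hy : y ∉ halfTree T v w) : x = w ∧ y = v := by
  have h1 := hT.dist_eq_dist_add_one_of_adj x h
  have h2 := hT.dist_eq_dist_add_one_of_adj y h
  have h3 := hT.dist_eq_dist_add_one_of_adj v hxy
  have h4 := hT.dist_eq_dist_add_one_of_adj w hxy
  simp only [halfTree, Set.mem_ofPred_eq] at hx hy
  simp only [T.dist_comm (u := v), T.dist_comm (u := w)] at h3 h4
  have h5 : T.dist x w = T.dist y v := by omega
  rcases Nat.eq_zero_or_pos (T.dist y v) with h0 | h0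
  · exact ⟨hT.connected.dist_eq_zero_iff.1 (h5.trans h0), hT.connected.dist_eq_zero_iff.1 h0⟩
  exfalso
  -- the neighbour of `y` towards `v` is also its neighbour towards `w`, which is `x`
  obtain ⟨p, hp⟩ := hT.connected.exists_walk_length_eq_dist y v
  cases p with
  | nil => simp at h0
  | @cons _ z _ hyz p =>
    have h6 := SimpleGraph.dist_le p
    simp only [SimpleGraph.Walk.length_cons] at hp
    have h7 := hT.dist_eq_dist_add_one_of_adj z h
    have h8 := hT.dist_eq_dist_add_one_of_adj w hyz
    have h9 := hT.dist_eq_dist_add_one_of_adj v hyz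
    simp only [T.dist_comm (u := v), T.dist_comm (u := w)] at h8 h9
    have hzx : z = x := by
      refine LegalLabelling.parent_unique hT (x := w) (v := y) hyz.symm hxy ?_ ?_ <;>
        simp only [T.dist_comm (u := w)] <;> omega
    subst hzx
    omega

theorem dist_eq_of_mem_halfTree (hT : T.IsTree) {v w x y : V} (h : T.Adj v w)
    (hx : x ∈ halfTree T v w) (hy : y ∉ halfTree T v w) :
    T.dist x y = T.dist x w + 1 + T.dist v y := by
  apply le_antisymm
  · have h1 := hT.connected.dist_triangle (u := x) (v := w) (w := y)
    have h2 := hT.connected.dist_triangle (u := w) (v := v) (w := y)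
    rw [SimpleGraph.dist_eq_one_iff_adj.2 h.symm] at h2
    omega
  · have key : ∀ {x y : V} (p : T.Walk x y), x ∈ halfTree T v w → y ∉ halfTree T v w →
        T.dist x w + 1 + T.dist v y ≤ p.length := by
      intro x y p
      induction p with
      | nil => exact fun h1 h2 => absurd h1 h2
      | @cons x z y hxz p ih =>
        intro hx hy
        rw [SimpleGraph.Walk.length_cons]
        by_cases hz : z ∈ halfTree T v w
        · have h1 := ih hz hy
          have h2 := hT.connected.dist_triangle (u := x) (v := z) (w := w)
          rw [SimpleGraph.dist_eq_one_iff_adj.2 hxz] at h2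
          omega
        · obtain ⟨rfl, rfl⟩ := eq_of_adj_of_mem_halfTree hT h hxz hx hz
          have := SimpleGraph.dist_le p
          rw [SimpleGraph.dist_self]
          omega
    obtain ⟨p, hp⟩ := hT.connected.exists_walk_length_eq_dist x y
    exact hp ▸ key p hx hy

theorem halfTree_subset_halfTree (hT : T.IsTree) {a b c : V} (hab : T.Adj a b)
    (hbc : T.Adj b c) (hac : a ≠ c) : halfTree T b c ⊆ halfTree T a b := by
  intro x hx
  by_contra hxa
  rw [← mem_halfTree_swap hT hab] at hxa
  have h1 := hT.dist_eq_dist_add_one_of_adj x hab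
  have h2 := hT.dist_eq_dist_add_one_of_adj x hbc
  simp only [halfTree, Set.mem_ofPred_eq] at hx hxa
  exact hac (LegalLabelling.parent_unique hT (x := x) (v := b) hab hbc.symm
    (by omega) (by omega))

end HalfTree

/-! ### Convergence of automorphisms to ends of the tree -/

section Limits

variable {V : Type u} {T : SimpleGraph V} {ι : Type*}

/-- A family `f` of automorphisms moves every vertex into `A` along a filter. For a family that
tends to infinity and a half-tree `A`, this says that the ends that are limits of `f` belong
to `A`. -/
def EventuallyInto (F : Filter ι) (f : ι → T ≃g T) (A : Set V) : Prop :=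
  ∀ y, ∀ᶠ i in F, f i y ∈ A

theorem EventuallyInto.mono {F : Filter ι} {f : ι → T ≃g T} {A B : Set V}
    (h : EventuallyInto F f A) (hAB : A ⊆ B) : EventuallyInto F f B :=
  fun y => (h y).mono fun _ hi => hAB hi

theorem eventuallyInto_halfTree_of_base (hT : T.IsTree) {F : Filter ι} {f : ι → T ≃g T} {x₀ : V}
    (hf : ∀ n : ℕ, ∀ᶠ i in F, n < T.dist x₀ (f i x₀)) {v w : V} (h : T.Adj v w)
    (hx : ∀ᶠ i in F, f i x₀ ∈ halfTree T v w) : EventuallyInto F f (halfTree T v w) := by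
  intro y
  filter_upwards [hx, hf (T.dist x₀ w + T.dist x₀ y)] with i h1 h2
  by_contra h3
  have h4 := dist_eq_of_mem_halfTree hT h h1 h3
  have h5 := hT.connected.dist_triangle (u := x₀) (v := w) (w := f i x₀)
  rw [dist_apply] at h4
  rw [T.dist_comm (u := w)] at h5
  omega

/-- An ultrafilter that tends to infinity converges to an end, which lies on one of the two sides
of every edge. -/
theorem eventuallyInto_halfTree_or (hT : T.IsTree) {F : Ultrafilter ι} {f : ι → T ≃g T} {x₀ : V}
    (hf : ∀ n : ℕ, ∀ᶠ i in (F : Filter ι), n < T.dist x₀ (f i x₀)) {v w : V} (h : T.Adj v w) :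
    EventuallyInto F f (halfTree T v w) ∨ EventuallyInto F f (halfTree T w v) := by
  rcases Ultrafilter.eventually_or.1 (Filter.Eventually.of_forall (f := (F : Filter ι))
    fun i => em (f i x₀ ∈ halfTree T v w)) with h1 | h1
  · exact Or.inl (eventuallyInto_halfTree_of_base hT hf h h1)
  · refine Or.inr (eventuallyInto_halfTree_of_base hT hf h.symm ?_)
    simpa only [mem_halfTree_swap hT h] using h1

/-- North-south dynamics: if `f` tends to an end on the `b`-side of the edge `{a, b}` and `f⁻¹`
does so too, then eventually `f⁻¹` maps all of the `a`-side into the `b`-side. -/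
theorem eventually_inv_maps_halfTree (hT : T.IsTree) {F : Filter ι} {f : ι → T ≃g T} {a b : V}
    (h : T.Adj a b) (hf : EventuallyInto F f (halfTree T a b))
    (hf' : EventuallyInto F (fun i => (f i)⁻¹) (halfTree T a b)) :
    ∀ᶠ i in F, ∀ y ∈ halfTree T b a, (f i)⁻¹ y ∈ halfTree T a b := by
  filter_upwards [hf b, hf' a, hf' b] with i h1 h2 h3 y hy
  by_contra h4
  have h5 := dist_eq_of_mem_halfTree hT h h2 h4
  have h6 := dist_eq_of_mem_halfTree hT h h3 h4
  simp only [dist_inv_apply, RelIso.apply_inv_self] at h5 h6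
  simp only [halfTree, Set.mem_ofPred_eq] at h1 hy
  rw [T.dist_comm, T.dist_comm (v := a)] at h1
  rw [T.dist_comm, T.dist_comm (v := b)] at hy
  omega

end Limits

/-! ### The subgroup generated by fixators of edge neighbourhoods -/

section Plus

variable {V : Type u} {T : SimpleGraph V}

theorem fixator_le_plusSubgroup (G : Subgroup (T ≃g T)) (k : ℕ) {v w : V} (h : T.Adj v w) :
    fixator G (closedBall T v k ∩ closedBall T w k) ≤ plusSubgroup G k := by
  intro g hg
  refine Subgroup.subset_closure ?_
  simp only [Set.mem_iUnion]
  exact ⟨v, w, h, hg⟩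

theorem plusSubgroup_le (G : Subgroup (T ≃g T)) (k : ℕ) : plusSubgroup G k ≤ G := by
  refine (Subgroup.closure_le _).2 ?_
  simp only [Set.iUnion_subset_iff]
  exact fun _ _ _ g hg => hg.1

theorem conj_mem_plusSubgroup {G : Subgroup (T ≃g T)} {k : ℕ} {t n : T ≃g T} (ht : t ∈ G)
    (hn : n ∈ plusSubgroup G k) : t * n * t⁻¹ ∈ plusSubgroup G k := by
  have hle : plusSubgroup G k ≤ (plusSubgroup G k).comap (MulAut.conj t).toMonoidHom := by
    refine (Subgroup.closure_le _).2 ?_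
    simp only [Set.iUnion_subset_iff]
    intro v w h g hg
    refine fixator_le_plusSubgroup G k (t.map_rel_iff.2 h)
      ⟨G.mul_mem (G.mul_mem ht hg.1) (G.inv_mem ht), ?_⟩
    rintro x ⟨hx1, hx2⟩
    have h1 : ∀ {v}, x ∈ closedBall T (t v) k → t⁻¹ x ∈ closedBall T v k := by
      intro v hx
      change T.dist v (t⁻¹ x) ≤ k
      rwa [← dist_apply t, RelIso.apply_inv_self]
    change t (g (t⁻¹ x)) = x
    rw [hg.2 _ ⟨h1 hx1, h1 hx2⟩, RelIso.apply_inv_self]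
  exact hle hn

end Plus

/-! ### The independence property -/

section Independence

variable {V : Type u} {T : SimpleGraph V}

open Classical in
/-- The map that agrees with `h` on the half-tree `halfTree T v w` and is the identity elsewhere. -/
noncomputable def halfMap (v w : V) (h : T ≃g T) (x : V) : V :=
  if x ∈ halfTree T v w then h x else x

theorem halfMap_of_mem {v w x : V} (h : T ≃g T) (hx : x ∈ halfTree T v w) :
    halfMap v w h x = h x := if_pos hx

theorem halfMap_of_notMem {v w x : V} (h : T ≃g T) (hx : x ∉ halfTree T v w) :
    halfMap v w h x = x := if_neg hx

theorem apply_mem_halfTree_iff_of_fixed {v w x : V} {h : T ≃g T} (hv : h v = v) (hw : h w = w) :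
    h x ∈ halfTree T v w ↔ x ∈ halfTree T v w := by
  conv_lhs => rw [← hv, ← hw]
  exact apply_mem_halfTree_iff h

theorem inv_apply_eq_of_fixed {h : T ≃g T} {v : V} (hv : h v = v) : h⁻¹ v = v := by
  conv_lhs => rw [← hv]
  exact RelIso.inv_apply_self h v

theorem halfMap_inv_halfMap {v w : V} {h : T ≃g T} (hv : h v = v) (hw : h w = w) (x : V) :
    halfMap v w h⁻¹ (halfMap v w h x) = x := by
  by_cases hx : x ∈ halfTree T v w
  · rw [halfMap_of_mem h hx,
      halfMap_of_mem _ ((apply_mem_halfTree_iff_of_fixed hv hw).2 hx), RelIso.inv_apply_self]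
  · rw [halfMap_of_notMem h hx, halfMap_of_notMem _ hx]

theorem adj_halfMap (hT : T.IsTree) {v w : V} (hvw : T.Adj v w) {h : T ≃g T}
    (hv : h v = v) (hw : h w = w) {x y : V} (hxy : T.Adj x y) :
    T.Adj (halfMap v w h x) (halfMap v w h y) := by
  by_cases hx : x ∈ halfTree T v w <;> by_cases hy : y ∈ halfTree T v w
  · rw [halfMap_of_mem h hx, halfMap_of_mem h hy]
    exact h.map_rel_iff.2 hxy
  · rw [halfMap_of_mem h hx, halfMap_of_notMem h hy]
    obtain ⟨rfl, rfl⟩ := eq_of_adj_of_mem_halfTree hT hvw hxy hx hy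
    rwa [hw]
  · rw [halfMap_of_notMem h hx, halfMap_of_mem h hy]
    obtain ⟨rfl, rfl⟩ := eq_of_adj_of_mem_halfTree hT hvw hxy.symm hy hx
    rwa [hw]
  · rwa [halfMap_of_notMem h hx, halfMap_of_notMem h hy]

/-- The automorphism that agrees with `h` on the half-tree `halfTree T v w` and is the identity
on the complementary half-tree, for an automorphism `h` that fixes `v` and `w`. -/
noncomputable def halfAut (hT : T.IsTree) {v w : V} (hvw : T.Adj v w) {h : T ≃g T}
    (hv : h v = v) (hw : h w = w) : T ≃g T where
  toFun := halfMap v w h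
  invFun := halfMap v w h⁻¹
  left_inv := halfMap_inv_halfMap hv hw
  right_inv x := by
    simpa using halfMap_inv_halfMap (inv_apply_eq_of_fixed hv) (inv_apply_eq_of_fixed hw) x
  map_rel_iff' {x y} := by
    refine ⟨fun hxy => ?_, adj_halfMap hT hvw hv hw⟩
    have := adj_halfMap hT hvw (inv_apply_eq_of_fixed hv) (inv_apply_eq_of_fixed hw) hxy
    simpa only [Equiv.coe_fn_mk, halfMap_inv_halfMap hv hw] using this

/-- If a ball of radius `k` around a vertex on one side of the edge `{v, w}` reaches a vertex `y`
on the other side, then `y` belongs to `B(v, k) ∩ B(w, k)`. -/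
theorem mem_closedBall_inter_of_dist_le (hT : T.IsTree) {v w x y : V} (hvw : T.Adj v w) {k : ℕ}
    (hxy : T.dist x y ≤ k) (hx : x ∈ halfTree T v w) (hy : y ∉ halfTree T v w) :
    y ∈ closedBall T v k ∩ closedBall T w k := by
  have h1 := dist_eq_of_mem_halfTree hT hvw hx hy
  have h2 := hT.connected.dist_triangle (u := w) (v := v) (w := y)
  rw [SimpleGraph.dist_eq_one_iff_adj.2 hvw.symm] at h2
  constructor <;> change T.dist _ _ ≤ k <;> omega

variable {d : ℕ}

theorem localAction_congr (hT : T.IsTree) (l : LegalLabelling T d) {k : ℕ} {g h : T ≃g T} {x : V}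
    (hgh : ∀ y ∈ closedBall T x k, g y = h y) :
    localAction hT l k g x = localAction hT l k h x := by
  have hx : g x = h x := hgh x (by simp [closedBall])
  refine localAction_unique hT l k g x _ fun s => ?_
  rw [hx, follow_localAction, hgh]
  exact (l.dist_follow hT x s.1 s.2.1).trans_le s.2.2

theorem halfAut_mem_fixator (hT : T.IsTree) (l : LegalLabelling T d) {k : ℕ}
    {F : Subgroup (ballGraph d k ≃g ballGraph d k)} {v w : V} (hvw : T.Adj v w) {h : T ≃g T}
    (hv : h v = v) (hw : h w = w)
    (hh : h ∈ fixator (universalGroup hT l k F) (closedBall T v k ∩ closedBall T w k)) :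
    halfAut hT hvw hv hw ∈
      fixator (universalGroup hT l k F) (closedBall T v k ∩ closedBall T w k) := by
  refine ⟨fun x => ?_, fun x hx => ?_⟩
  · by_cases hx : x ∈ halfTree T v w
    · rw [localAction_congr hT l (h := h)]
      · exact hh.1 x
      intro y hy
      by_cases hyA : y ∈ halfTree T v w
      · exact halfMap_of_mem h hyA
      · rw [hh.2 y (mem_closedBall_inter_of_dist_le hT hvw hy hx hyA)]
        exact halfMap_of_notMem h hyA
    · rw [localAction_congr hT l (h := 1), localAction_one]
      · exact F.one_mem
      intro y hy
      by_cases hyA : y ∈ halfTree T v w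
      · have := mem_closedBall_inter_of_dist_le hT hvw.symm hy
          ((mem_halfTree_swap hT hvw).2 hx) (by rwa [mem_halfTree_swap hT hvw, not_not])
        exact (halfMap_of_mem h hyA).trans (hh.2 y this.symm)
      · exact halfMap_of_notMem h hyA
  · by_cases hxA : x ∈ halfTree T v w
    · exact (halfMap_of_mem h hxA).trans (hh.2 x hx)
    · exact halfMap_of_notMem h hxA

/-- The independence property `P_k` of Banks, Elder and Willis: an element of `U_k(F)` that fixes
`B(v, k) ∩ B(w, k)` is a product of two such elements, each of which fixes one of the two
half-trees cut off by the edge `{v, w}`. -/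
theorem exists_mul_eq_of_mem_fixator (hT : T.IsTree) (l : LegalLabelling T d) {k : ℕ}
    (hk : 1 ≤ k) {F : Subgroup (ballGraph d k ≃g ballGraph d k)} {v w : V} (hvw : T.Adj v w)
    {h : T ≃g T}
    (hh : h ∈ fixator (universalGroup hT l k F) (closedBall T v k ∩ closedBall T w k)) :
    ∃ h₁ ∈ fixator (universalGroup hT l k F) (closedBall T v k ∩ closedBall T w k),
    ∃ h₂ ∈ fixator (universalGroup hT l k F) (closedBall T v k ∩ closedBall T w k),
      (∀ x ∈ halfTree T w v, h₁ x = x) ∧ (∀ x ∈ halfTree T v w, h₂ x = x) ∧ h = h₁ * h₂ := by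
  have h1 := SimpleGraph.dist_eq_one_iff_adj.2 hvw
  have hv : h v = v := hh.2 v (by simp [closedBall, h1, T.dist_comm (u := w), hk])
  have hw : h w = w := hh.2 w (by simp [closedBall, h1, hk])
  have hmem := halfAut_mem_fixator hT l hvw hv hw hh
  refine ⟨_, hmem, (halfAut hT hvw hv hw)⁻¹ * h, Subgroup.mul_mem _ (Subgroup.inv_mem _ hmem) hh,
    fun x hx => halfMap_of_notMem h ((mem_halfTree_swap hT hvw).1 hx), fun x hx => ?_, by group⟩
  have h2 : halfAut hT hvw hv hw x = h x := halfMap_of_mem h hx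
  rw [RelIso.mul_apply, ← h2, RelIso.inv_apply_self]

end Independence

/-! ### Label-preserving automorphisms -/

section LabelPreserving

variable {V : Type u} {T : SimpleGraph V} {d : ℕ}

/-- The words in `d` letters without two equal consecutive letters parametrise the vertices of the
tree, once a base vertex `x` is chosen. -/
noncomputable def wordEquiv (hT : T.IsTree) (l : LegalLabelling T d) (x : V) :
    {s : List (Fin d) // s.IsChain (· ≠ ·)} ≃ V :=
  Equiv.ofBijective (fun s => l.follow x s.1)
    ⟨fun s t h => Subtype.ext (l.follow_injective hT x _ _ s.2 t.2 h), fun v => by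
      obtain ⟨s, hs, -, hf⟩ := l.exists_follow_eq hT x _ v rfl
      exact ⟨⟨s, hs⟩, hf⟩⟩

/-- The label-preserving automorphism that maps `x` to `y`. -/
noncomputable def labelAut (hT : T.IsTree) (l : LegalLabelling T d) (x y : V) : T ≃g T where
  toEquiv := (wordEquiv hT l x).symm.trans (wordEquiv hT l y)
  map_rel_iff' {a b} := by
    obtain ⟨s, rfl⟩ := (wordEquiv hT l x).surjective a
    obtain ⟨t, rfl⟩ := (wordEquiv hT l x).surjective b
    simp only [Equiv.trans_apply, Equiv.symm_apply_apply]
    exact (l.adj_follow_iff hT y s.2 t.2).trans (l.adj_follow_iff hT x s.2 t.2).symm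

theorem labelAut_follow_of_isChain (hT : T.IsTree) (l : LegalLabelling T d) (x y : V)
    {s : List (Fin d)} (hs : s.IsChain (· ≠ ·)) :
    labelAut hT l x y (l.follow x s) = l.follow y s := by
  change wordEquiv hT l y ((wordEquiv hT l x).symm (wordEquiv hT l x ⟨s, hs⟩)) = _
  rw [Equiv.symm_apply_apply]
  rfl

theorem labelAut_self (hT : T.IsTree) (l : LegalLabelling T d) (x y : V) :
    labelAut hT l x y x = y :=
  labelAut_follow_of_isChain hT l x y (s := []) (by simp)

theorem labelAut_nbr (hT : T.IsTree) (l : LegalLabelling T d) (x y u : V) (i : Fin d) :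
    labelAut hT l x y (l.nbr u i) = l.nbr (labelAut hT l x y u) i := by
  obtain ⟨s, hs, -, rfl⟩ := l.exists_follow_eq hT x _ u rfl
  rw [labelAut_follow_of_isChain hT l x y hs]
  by_cases h : (i :: s).IsChain (· ≠ ·)
  · exact labelAut_follow_of_isChain hT l x y h
  · cases s with
    | nil => simp at h
    | cons j s =>
      obtain rfl : i = j := by
        by_contra hij
        exact h (List.isChain_cons_cons.2 ⟨hij, hs⟩)
      change labelAut hT l x y (l.nbr (l.nbr (l.follow x s) i) i) =
        l.nbr (l.nbr (l.follow y s) i) i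
      rw [l.nbr_nbr, l.nbr_nbr]
      exact labelAut_follow_of_isChain hT l x y hs.tail

theorem labelAut_mem_universalGroup (hT : T.IsTree) (l : LegalLabelling T d) {k : ℕ}
    (F : Subgroup (ballGraph d k ≃g ballGraph d k)) (x y : V) :
    labelAut hT l x y ∈ universalGroup hT l k F := by
  intro u
  have key : ∀ s : List (Fin d),
      l.follow (labelAut hT l x y u) s = labelAut hT l x y (l.follow u s) := by
    intro s
    induction s with
    | nil => rfl
    | cons i s ih =>
      change l.nbr _ i = labelAut hT l x y (l.nbr _ i)
      rw [labelAut_nbr, ih]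
  rw [localAction_unique hT l k _ u 1 fun s => key s.1]
  exact F.one_mem

end LabelPreserving

/-! ### Bounded ultrafilters -/

section Compactness

variable {V : Type u} {T : SimpleGraph V} {d : ℕ}

theorem finite_closedBall (hT : T.IsTree) (l : LegalLabelling T d) (x : V) (n : ℕ) :
    (closedBall T x n).Finite := by
  refine ((List.finite_length_le (Fin d) n).image (l.follow x)).subset fun v hv => ?_
  obtain ⟨s, -, hs, hf⟩ := l.exists_follow_eq hT x _ v rfl
  exact ⟨s, hs.trans_le hv, hf⟩

theorem _root_.Ultrafilter.exists_eventually_eq_of_finite {ι α : Type*} (F : Ultrafilter ι)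
    {f : ι → α} {s : Set α} (hs : s.Finite) (h : ∀ᶠ i in (F : Filter ι), f i ∈ s) :
    ∃ a, ∀ᶠ i in (F : Filter ι), f i = a := by
  obtain ⟨a, -, ha⟩ := (Ultrafilter.finite_biUnion_mem_iff (f := F) hs
    (s := fun a => {i | f i = a})).1 (by
      filter_upwards [h] with i hi
      simpa using hi)
  exact ⟨a, ha⟩

/-- Point stabilisers are relatively compact: an ultrafilter of automorphisms that do not move a
vertex arbitrarily far away converges pointwise to an automorphism. -/
theorem exists_eventually_apply_eq (hT : T.IsTree) (l : LegalLabelling T d) {ι : Type*}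
    (F : Ultrafilter ι) (f : ι → T ≃g T) {x₀ x₁ : V}
    (hf : ∀ᶠ i in (F : Filter ι), f i x₀ = x₁) :
    ∃ a : T ≃g T, ∀ y, ∀ᶠ i in (F : Filter ι), f i y = a y := by
  have key : ∀ (f : ι → T ≃g T) (x₀ x₁ : V), (∀ᶠ i in (F : Filter ι), f i x₀ = x₁) →
      ∀ y, ∃ z, ∀ᶠ i in (F : Filter ι), f i y = z := by
    intro f x₀ x₁ hf y
    refine F.exists_eventually_eq_of_finite (finite_closedBall hT l x₁ (T.dist x₀ y)) ?_
    filter_upwards [hf] with i hi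
    change T.dist _ _ ≤ _
    rw [← hi, dist_apply]
  choose p hp using key f x₀ x₁ hf
  choose q hq using key (fun i => (f i)⁻¹) x₁ x₀ (by
    filter_upwards [hf] with i hi
    rw [← hi, RelIso.inv_apply_self])
  refine ⟨⟨⟨p, q, fun y => ?_, fun y => ?_⟩, ?_⟩, hp⟩
  · obtain ⟨i, h1, h2⟩ := ((hp y).and (hq (p y))).exists
    rw [← h2, ← h1, RelIso.inv_apply_self]
  · obtain ⟨i, h1, h2⟩ := ((hq y).and (hp (q y))).exists
    rw [← h2, ← h1, RelIso.apply_inv_self]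
  · intro y z
    obtain ⟨i, h1, h2⟩ := ((hp y).and (hp z)).exists
    change T.Adj (p y) (p z) ↔ _
    rw [← h1, ← h2]
    exact (f i).map_rel_iff

/-- `U_k(F)^{+_k}` is closed under pointwise limits: `U_k(F)` is closed because the `k`-local
actions are determined on finite balls, and `U_k(F)^{+_k}` is an open subgroup of it. -/
theorem mem_plusSubgroup_of_eventually (hT : T.IsTree) (l : LegalLabelling T d) {k : ℕ}
    {F : Subgroup (ballGraph d k ≃g ballGraph d k)} {v w : V} (hvw : T.Adj v w) {ι : Type*}
    {L : Filter ι} [L.NeBot] {f : ι → T ≃g T}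
    (hf : ∀ i, f i ∈ plusSubgroup (universalGroup hT l k F) k) {a : T ≃g T}
    (ha : ∀ y, ∀ᶠ i in L, f i y = a y) :
    a ∈ plusSubgroup (universalGroup hT l k F) k := by
  have hball : ∀ x, ∀ᶠ i in L, ∀ y ∈ closedBall T x k, f i y = a y := fun x =>
    (finite_closedBall hT l x k).eventually_all.2 fun y _ => ha y
  have haU : a ∈ universalGroup hT l k F := by
    intro x
    obtain ⟨i, hi⟩ := (hball x).exists
    rw [← localAction_congr hT l hi]
    exact plusSubgroup_le _ _ (hf i) x
  obtain ⟨i, hi⟩ := (hball v).exists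
  have h1 : (f i)⁻¹ * a ∈ plusSubgroup (universalGroup hT l k F) k := by
    refine fixator_le_plusSubgroup _ k hvw
      ⟨Subgroup.mul_mem _ (Subgroup.inv_mem _ (plusSubgroup_le _ _ (hf i))) haU, fun x hx => ?_⟩
    rw [RelIso.mul_apply, ← hi x hx.1, RelIso.inv_apply_self]
  simpa using Subgroup.mul_mem _ (hf i) h1

theorem tendsto_nhds_of_eventually_apply_eq {ι : Type*} {L : Filter ι} {f : ι → T ≃g T}
    {a : T ≃g T} (ha : ∀ y, ∀ᶠ i in L, f i y = a y) : Filter.Tendsto f L (nhds a) := by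
  rw [isTopologicalBasis_basicNhd.nhds_hasBasis.tendsto_right_iff]
  rintro _ ⟨⟨g₀, S, hS, rfl⟩, haS⟩
  filter_upwards [hS.eventually_all.2 fun y _ => ha y] with i hi y hy
  rw [hi y hy, haS y hy]

end Compactness

/-! ### The line -/

section LineCase

variable {V : Type u} {T : SimpleGraph V}

/-- An automorphism of a line that fixes two adjacent vertices is trivial. -/
theorem eq_one_of_fixed_of_adj (hT : T.IsTree) (l : LegalLabelling T 2) {h : T ≃g T} {v w : V}
    (hvw : T.Adj v w) (hv : h v = v) (hw : h w = w) : h = 1 := by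
  have key : ∀ {x y z : V}, T.Adj x y → T.Adj x z → h x = x → h y = y → h z = z := by
    intro x y z hxy hxz hx hy
    by_cases hyz : y = z
    · rwa [← hyz]
    have hhz : T.Adj x (h z) := by
      conv_lhs => rw [← hx]
      exact h.map_rel_iff.2 hxz
    have hyhz : y ≠ h z := fun e => hyz (h.injective (hy.trans e))
    have h1 : l.label.get x y hxy ≠ l.label.get x z hxz := fun e =>
      hyz (by rw [← l.nbr_label hxy, e, l.nbr_label])
    have h2 : l.label.get x y hxy ≠ l.label.get x (h z) hhz := fun e =>
      hyhz (by rw [← l.nbr_label hxy, e, l.nbr_label])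
    have h3 : ∀ i j m : Fin 2, i ≠ j → i ≠ m → m = j := by decide
    rw [← l.nbr_label hhz, h3 _ _ _ h1 h2, l.nbr_label]
  have all : ∀ {x z : V} (p : T.Walk x z) {y : V}, T.Adj x y → h x = x → h y = y → h z = z := by
    intro x z p
    induction p with
    | nil => exact fun _ hx _ => hx
    | cons hxz p ih => exact fun hxy hx hy => ih hxz.symm (key hxy hxz hx hy) hx
  refine RelIso.ext fun z => ?_
  obtain ⟨p⟩ := hT.connected.preconnected v z
  exact all p hvw hv hw

end LineCase

/-! ### Contraction and triviality of the homomorphism -/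

section ClosedRange

variable {V : Type u} {T : SimpleGraph V} {d : ℕ}

/-- The contraction argument: let `φ` converge along an ultrafilter `L` in a subgroup of `Aut(T)`.
If the inverses of the group elements move everything into `A`, then conjugation along `L`
contracts every element `n` that fixes `A` pointwise to the identity, so `φ` kills `n`. -/
theorem map_eq_one_of_eventuallyInto {N : Subgroup (T ≃g T)} {H : Type w} [Group H]
    [TopologicalSpace H] [IsTopologicalGroup H] [T2Space H] {φ : N →* H} (hφ : Continuous φ)
    {L : Filter N} [L.NeBot] {y : H} (hy : Filter.Tendsto φ L (nhds y)) {A : Set V}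
    (hA : EventuallyInto L (fun g => (g : T ≃g T)⁻¹) A) {n : N}
    (hn : ∀ x ∈ A, (n : T ≃g T) x = x) : φ n = 1 := by
  have h1 : Filter.Tendsto (fun g : N => g * n * g⁻¹) L (nhds 1) := by
    rw [tendsto_subtype_rng]
    refine tendsto_nhds_of_eventually_apply_eq fun x => ?_
    filter_upwards [hA x] with g hg
    change (g : T ≃g T) ((n : T ≃g T) ((g : T ≃g T)⁻¹ x)) = x
    rw [hn _ hg, RelIso.apply_inv_self]
  have h2 := (hφ.tendsto 1).comp h1
  have h3 : Filter.Tendsto (φ ∘ fun g : N => g * n * g⁻¹) L (nhds (y * φ n * y⁻¹)) := by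
    simp only [Function.comp_def, map_mul, map_inv]
    exact (hy.mul_const _).mul hy.inv
  have h4 := tendsto_nhds_unique h3 h2
  rw [map_one] at h4
  simpa using h4

/-- The contraction argument, freed from the condition on the position of the half-tree. -/
theorem map_eq_one_of_fixes_halfTree (hT : T.IsTree) (l : LegalLabelling T d) (hd : 3 ≤ d) {k : ℕ}
    {F : Subgroup (ballGraph d k ≃g ballGraph d k)} {H : Type w} [Group H]
    [TopologicalSpace H] [IsTopologicalGroup H] [T2Space H]
    {φ : plusSubgroup (universalGroup hT l k F) k →* H} (hφ : Continuous φ)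
    {L : Ultrafilter (plusSubgroup (universalGroup hT l k F) k)} {y : H}
    (hy : Filter.Tendsto φ L (nhds y)) {x₀ : V}
    (hL : ∀ m : ℕ, ∀ᶠ g : plusSubgroup (universalGroup hT l k F) k in (L : Filter _),
      m < T.dist x₀ ((g : T ≃g T) x₀))
    {a b : V} (hab : T.Adj a b) {n : plusSubgroup (universalGroup hT l k F) k}
    (hn : ∀ x ∈ halfTree T a b, (n : T ≃g T) x = x) : φ n = 1 := by
  have hL' : ∀ m : ℕ, ∀ᶠ g : plusSubgroup (universalGroup hT l k F) k in (L : Filter _),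
      m < T.dist x₀ ((g : T ≃g T)⁻¹ x₀) := fun m => by
    filter_upwards [hL m] with g hg
    rwa [T.dist_comm, dist_inv_apply]
  rcases eventuallyInto_halfTree_or hT hL' hab with hξ | hξ
  · exact map_eq_one_of_eventuallyInto hφ hy hξ hn
  -- a neighbour `c ≠ a` of `b` such that the half-tree behind it does not contain the limit of `L`
  obtain ⟨j, hja, hη⟩ : ∃ j, l.nbr b j ≠ a ∧ EventuallyInto L
      (fun g : plusSubgroup (universalGroup hT l k F) k => (g : T ≃g T))
      (halfTree T (l.nbr b j) b) := by
    obtain ⟨j₁, j₂, h12, h1, h2⟩ : ∃ j₁ j₂ : Fin d, j₁ ≠ j₂ ∧ l.nbr b j₁ ≠ a ∧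
        l.nbr b j₂ ≠ a := by
      have hcard : 1 < (Finset.univ.erase (l.label.get b a hab.symm)).card := by
        rw [Finset.card_erase_of_mem (Finset.mem_univ _), Finset.card_fin]
        omega
      obtain ⟨j₁, h1, j₂, h2, h12⟩ := Finset.one_lt_card.1 hcard
      have hne : ∀ j ∈ Finset.univ.erase (l.label.get b a hab.symm), l.nbr b j ≠ a :=
        fun j hj e => Finset.ne_of_mem_erase hj
          (l.nbr_injective b (e.trans (l.nbr_label hab.symm).symm))
      exact ⟨j₁, j₂, h12, hne _ h1, hne _ h2⟩
    rcases eventuallyInto_halfTree_or hT hL (l.adj_nbr b j₁) with h3 | h3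
    · exact ⟨j₂, h2, h3.mono (halfTree_subset_halfTree hT (l.adj_nbr b j₂).symm (l.adj_nbr b j₁)
        fun e => h12 (l.nbr_injective b e).symm)⟩
    · exact ⟨j₁, h1, h3⟩
  set c := l.nbr b j with hc
  have hbc : T.Adj b c := l.adj_nbr b j
  -- the label-preserving inversion of the edge `{b, c}`
  set t := labelAut hT l b c with ht
  have htb : t b = c := labelAut_self hT l b c
  have htc : t c = b := by
    rw [hc, ht, labelAut_nbr, labelAut_self, hc, l.nbr_nbr]
  have htU : t ∈ universalGroup hT l k F := labelAut_mem_universalGroup hT l F b c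
  have hsub : halfTree T b c ⊆ halfTree T a b := halfTree_subset_halfTree hT hab hbc hja.symm
  have hξ' := hξ.mono (halfTree_subset_halfTree hT hbc.symm hab.symm hja)
  -- `t` moves both limits into `halfTree T a b`
  have hsub' : halfTree T c b ⊆ halfTree T (t⁻¹ a) (t⁻¹ b) := fun x hx => by
    rw [← apply_mem_halfTree_iff t, RelIso.apply_inv_self, RelIso.apply_inv_self]
    refine hsub ?_
    rwa [← apply_mem_halfTree_iff t, htb, htc] at hx
  obtain ⟨g, hg⟩ := (eventually_inv_maps_halfTree hT
    (show T.Adj (t⁻¹ a) (t⁻¹ b) from (t⁻¹).map_rel_iff.2 hab)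
    (hη.mono hsub') (hξ'.mono hsub')).exists
  set m : plusSubgroup (universalGroup hT l k F) k :=
    ⟨t * g * t⁻¹, conj_mem_plusSubgroup htU g.2⟩ with hm
  have hmA : ∀ x ∈ halfTree T b a, (m : T ≃g T)⁻¹ x ∈ halfTree T a b := by
    intro x hx
    have h1 := hg (t⁻¹ x) ((apply_mem_halfTree_iff t⁻¹).2 hx)
    rw [← apply_mem_halfTree_iff t, RelIso.apply_inv_self, RelIso.apply_inv_self] at h1
    have h2 : (m : T ≃g T)⁻¹ = t * (g : T ≃g T)⁻¹ * t⁻¹ := by simp [hm, mul_assoc]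
    rw [h2]
    exact h1
  have hmn : φ (m * n * m⁻¹) = 1 := by
    refine map_eq_one_of_eventuallyInto hφ hy
      (A := halfTree T ((m : T ≃g T) a) ((m : T ≃g T) b)) ?_ ?_
    · intro x
      filter_upwards [hξ x] with f hf
      exact (inv_apply_mem_halfTree_iff _).1 (hmA _ hf)
    · intro x hx
      change (m : T ≃g T) ((n : T ≃g T) ((m : T ≃g T)⁻¹ x)) = x
      rw [hn _ ((inv_apply_mem_halfTree_iff _).2 hx), RelIso.apply_inv_self]
  simpa using hmn

end ClosedRange

end TreeAut

theorem mainTheorem8 {V : Type u} (T : SimpleGraph V) (hT : T.IsTree) [T.LocallyFinite]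
    (d : ℕ) (hd : 2 ≤ d) (hreg : T.IsRegularOfDegree d) (l : TreeAut.LegalLabelling T d)
    (k : ℕ) (hk : 1 ≤ k)
    (F : Subgroup (TreeAut.ballGraph d k ≃g TreeAut.ballGraph d k)) :
    HasClosedRangeProperty.{u, w}
      (TreeAut.plusSubgroup (TreeAut.universalGroup hT l k F) k) := by
  open TreeAut in
  intro H _ _ _ _ φ hφ
  refine isClosed_of_closure_subset fun y hy => ?_
  have hne : (Filter.comap φ (nhds y)).NeBot := by
    rwa [Filter.comap_neBot_iff_frequently, ← mem_closure_iff_frequently]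
  set L := Ultrafilter.of (Filter.comap φ (nhds y))
  have hLy : Filter.Tendsto φ L (nhds y) :=
    Filter.tendsto_comap.mono_left (Ultrafilter.of_le _)
  obtain ⟨x₀⟩ := hT.connected.nonempty
  have hadj := l.adj_nbr x₀ ⟨0, by omega⟩
  -- the limit of `L` is either an element of the group or an end of the tree
  by_cases hbd : ∃ x₁, ∀ᶠ g : plusSubgroup (universalGroup hT l k F) k in (L : Filter _),
      (g : T ≃g T) x₀ = x₁
  · obtain ⟨x₁, hx₁⟩ := hbd
    obtain ⟨a, ha⟩ := exists_eventually_apply_eq hT l L (fun g => (g : T ≃g T)) hx₁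
    have haN := mem_plusSubgroup_of_eventually hT l hadj (fun g => g.2) ha
    have h1 : Filter.Tendsto id (L : Filter (plusSubgroup (universalGroup hT l k F) k))
        (nhds ⟨a, haN⟩) := by
      rw [tendsto_subtype_rng]
      exact tendsto_nhds_of_eventually_apply_eq ha
    exact ⟨⟨a, haN⟩, tendsto_nhds_unique ((hφ.tendsto _).comp h1) hLy⟩
  have hL : ∀ m : ℕ, ∀ᶠ g : plusSubgroup (universalGroup hT l k F) k in (L : Filter _),
      m < T.dist x₀ ((g : T ≃g T) x₀) := by
    intro m
    by_contra hm
    rw [← Ultrafilter.eventually_not] at hm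
    exact hbd (L.exists_eventually_eq_of_finite (finite_closedBall hT l x₀ m)
      (hm.mono fun g hg => not_lt.1 hg))
  -- `L` tends to an end: `φ` kills the generators, hence `φ = 1` and `y = 1`
  have htriv : ∀ n, φ n = 1 := by
    rintro ⟨n, hn⟩
    induction hn using Subgroup.closure_induction with
    | mem h hh =>
      simp only [Set.mem_iUnion] at hh
      obtain ⟨v, w, hvw, hh⟩ := hh
      -- on a line there is no room for the contraction argument, but the group is trivial
      rcases hd.eq_or_lt with rfl | hd3
      · have h1 := SimpleGraph.dist_eq_one_iff_adj.2 hvw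
        obtain rfl := eq_one_of_fixed_of_adj hT l hvw
          (hh.2 v (by simp [closedBall, h1, T.dist_comm (u := w), hk]))
          (hh.2 w (by simp [closedBall, h1, hk]))
        exact map_one φ
      · obtain ⟨h₁, hm₁, h₂, hm₂, hf₁, hf₂, rfl⟩ := exists_mul_eq_of_mem_fixator hT l hk hvw hh
        have e₁ := map_eq_one_of_fixes_halfTree hT l hd3 hφ hLy hL hvw.symm
          (n := ⟨h₁, fixator_le_plusSubgroup _ k hvw hm₁⟩) hf₁
        have e₂ := map_eq_one_of_fixes_halfTree hT l hd3 hφ hLy hL hvw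
          (n := ⟨h₂, fixator_le_plusSubgroup _ k hvw hm₂⟩) hf₂
        have := map_mul φ ⟨h₁, fixator_le_plusSubgroup _ k hvw hm₁⟩
          ⟨h₂, fixator_le_plusSubgroup _ k hvw hm₂⟩
        rwa [e₁, e₂, one_mul] at this
    | one => exact map_one φ
    | mul x z hx hz ihx ihz =>
      have := map_mul φ ⟨x, hx⟩ ⟨z, hz⟩
      rwa [ihx, ihz, one_mul] at this
    | inv x hx ihx =>
      have := map_inv φ ⟨x, hx⟩
      rwa [ihx, inv_one] at this
  refine ⟨1, ?_⟩
  rw [htriv]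
  refine tendsto_nhds_unique (f := φ) (l := (L : Filter _)) ?_ hLy
  simp only [tendsto_const_nhds, funext htriv]
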